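/- Let $(\mu,\theta_1,\theta_2)$ be the coordinates $\xi_1=\sinh\mu\sin\theta_1\cos\theta_2$, $\xi_2=\sinh\mu\sin\theta_1\sin\theta_2$, $\xi_3=\sinh\mu\cos\theta_1$, $\xi_4=\cosh\mu$ on the upper sheet of the hyperboloid $\xi_4^2-\xi_1^2-\xi_2^2-\xi_3^2=1$, and let $V_3=L^2(\nu)$, where $\nu$ is either $d\mu\,d\Omega$ ($\mu\in\mathbb R$) or the Lorentz-invariant measure $\sinh^2\mu\,d\mu\,d\Omega$ ($\mu>0$), with $d\Omega=\sin\theta_1\,d\theta_1d\theta_2$, $0<\theta_1<\pi$, $0<\theta_2<2\pi$. Consider the generators of $iso(3,1)$ on functions of $(\mu,\theta_1,\theta_2)$: $\mathfrak I$ is multiplication by $\cosh\mu$, $P^i$ is multiplication by $\xi_i$, and $$Q^1=i\Big(\sin\theta_1\cos\theta_2\,\partial_\mu+\coth\mu\big(\cos\theta_1\cos\theta_2\,\partial_{\theta_1}-\tfrac{\sin\theta_2}{\sin\theta_1}\partial_{\theta_2}\big)\Big),$$ $$Q^2=i\Big(\sin\theta_1\sin\theta_2\,\partial_\mu+\coth\mu\big(\cos\theta_1\sin\theta_2\,\partial_{\theta_1}+\tfrac{\cos\theta_2}{\sin\theta_1}\partial_{\theta_2}\big)\Big),$$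 $$Q^3=i\big(\cos\theta_1\,\partial_\mu-\coth\mu\sin\theta_1\,\partial_{\theta_1}\big).$$ Put $A_\pm^i=\frac1{\sqrt2}(Q^i\mp iP^i)$ and $\psi_0=N^{-1/2}e^{-\cosh\mu}$, where $N$ is the squared norm of $e^{-\cosh\mu}$ in $V_3$. Let $h=L^2([0,\infty))$ and $H_3=h\otimes V_3=L^2([0,\infty)\times\text{hyperboloid})$. For $\psi\in V_3$ and $g\in h$ write $\psi(g)=g\otimes\psi$. For an operator $B$ on functions on the hyperboloid and a bounded function $f$ on $[0,\infty)$, let $B(f)$ be (multiplication by $f$)$\,\otimes B$, so that $B(f)\psi(g)=(B\psi)(fg)$. Put $B(t)=B(\chi_{[0,t]})$, $dB(t)=B(t+dt)-B(t)$ and $B(dt)=B(\chi_{(t,t+dt]})$, for $t\ge0$ and $dt\ge0$. Then $\psi_0$ is a unit vector of $V_3$, the vectors $dA_\pm^i(t)\psi_0(g)$ and $d\mathfrak I(t)\psi_0(g)$ belong to $H_3$ for all $g\in h$, and the following multiplication rules hold for all $i,j\in\{1,2,3\}$ and all $t,dt\ge0$: $$dA_-^i(t)\,dA_+^j(t)=\delta^{ij}\,\mathfrak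 I(dt),\qquad dA_+^i(t)\,dA_-^j(t)=0,$$ $$dA_-^i(t)\,d\mathfrak I(t)=-d\mathfrak I(t)\,dA_-^i(t)=\tfrac12\big(A_-^i(dt)-A_+^i(dt)\big),$$ and also $-d\mathfrak I(t)\,dA_+^i(t)=\tfrac12\big(A_-^i(dt)-A_+^i(dt)\big)$. Here $X=Y$ is understood for expectations in the state $\psi_0$: for all $f,g\in h$ the vectors $X\psi_0(g)$ and $Y\psi_0(g)$ belong to $H_3$ and $\langle\psi_0(f),X\psi_0(g)\rangle=\langle\psi_0(f),Y\psi_0(g)\rangle$. Moreover, the rules for $dA_-^i\,dA_+^j$, $dA_+^i\,dA_-^j$ and $dA_-^i\,d\mathfrak I$ hold as identities of vectors $X\psi_0(g)=Y\psi_0(g)$ in $H_3$, for every $g\in h$. -/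

import Mathlib

open MeasureTheory Set
open scoped ComplexConjugate

noncomputable section

namespace IsoThreeOne

/-- Coordinates `(μ, θ₁, θ₂)` on the upper sheet `ξ₄² - ξ₁² - ξ₂² - ξ₃² = 1`, `ξ₄ > 0`, of the
hyperboloid; functions on the hyperboloid are written in these coordinates. -/
abbrev Chart : Type := ℝ × ℝ × ℝ

/-- `g₁ = sin θ₁ cos θ₂`, `g₂ = sin θ₁ sin θ₂`, `g₃ = cos θ₁`. -/
def direction : Fin 3 → Chart → ℝ
  | 0, x => Real.sin x.2.1 * Real.cos x.2.2
  | 1, x => Real.sin x.2.1 * Real.sin x.2.2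
  | 2, x => Real.cos x.2.1

/-- `∂ψ/∂μ`. -/
def partialMu (ψ : Chart → ℂ) (x : Chart) : ℂ :=
  deriv (fun m : ℝ => ψ (m, x.2.1, x.2.2)) x.1

/-- `∂ψ/∂θ₁`. -/
def partialTheta1 (ψ : Chart → ℂ) (x : Chart) : ℂ :=
  deriv (fun a : ℝ => ψ (x.1, a, x.2.2)) x.2.1

/-- `∂ψ/∂θ₂`. -/
def partialTheta2 (ψ : Chart → ℂ) (x : Chart) : ℂ :=
  deriv (fun b : ℝ => ψ (x.1, x.2.1, b)) x.2.2

def coth (m : ℝ) : ℝ := Real.cosh m / Real.sinh m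

/-- The generator `𝔍`: multiplication by `ξ₄ = cosh μ`. -/
def opJ (ψ : Chart → ℂ) (x : Chart) : ℂ := (Real.cosh x.1 : ℂ) * ψ x

/-- The generators `Pⁱ`: multiplication by `ξᵢ = sinh μ · gᵢ(θ₁, θ₂)`. -/
def opP (i : Fin 3) (ψ : Chart → ℂ) (x : Chart) : ℂ :=
  ((Real.sinh x.1 * direction i x : ℝ) : ℂ) * ψ x

/-- The generators `Qⁱ` (boosts) as first order differential operators. -/
def opQ : Fin 3 → (Chart → ℂ) → Chart → ℂ
  | 0, ψ, x => Complex.I *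
      (((Real.sin x.2.1 * Real.cos x.2.2 : ℝ) : ℂ) * partialMu ψ x
        + (coth x.1 : ℂ) *
          (((Real.cos x.2.1 * Real.cos x.2.2 : ℝ) : ℂ) * partialTheta1 ψ x
            - ((Real.sin x.2.2 / Real.sin x.2.1 : ℝ) : ℂ) * partialTheta2 ψ x))
  | 1, ψ, x => Complex.I *
      (((Real.sin x.2.1 * Real.sin x.2.2 : ℝ) : ℂ) * partialMu ψ x
        + (coth x.1 : ℂ) *
          (((Real.cos x.2.1 * Real.sin x.2.2 : ℝ) : ℂ) * partialTheta1 ψ x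
            + ((Real.cos x.2.2 / Real.sin x.2.1 : ℝ) : ℂ) * partialTheta2 ψ x))
  | 2, ψ, x => Complex.I *
      ((Real.cos x.2.1 : ℂ) * partialMu ψ x
        - (coth x.1 : ℂ) * (Real.sin x.2.1 : ℂ) * partialTheta1 ψ x)

/-- `A₋ⁱ = (Qⁱ + i Pⁱ) / √2`. -/
def opAminus (i : Fin 3) (ψ : Chart → ℂ) (x : Chart) : ℂ :=
  1 / (Real.sqrt 2 : ℂ) * (opQ i ψ x + Complex.I * opP i ψ x)

/-- `A₊ⁱ = (Qⁱ - i Pⁱ) / √2`. -/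
def opAplus (i : Fin 3) (ψ : Chart → ℂ) (x : Chart) : ℂ :=
  1 / (Real.sqrt 2 : ℂ) * (opQ i ψ x - Complex.I * opP i ψ x)

/-- The measure `dΩ = sin θ₁ dθ₁ dθ₂` on `0 < θ₁ < π`, `0 < θ₂ < 2π`. -/
def sphereMeasure : Measure (ℝ × ℝ) :=
  ((volume.restrict (Ioo 0 Real.pi)).withDensity fun a => ENNReal.ofReal (Real.sin a)).prod
    (volume.restrict (Ioo 0 (2 * Real.pi)))

/-- The measure `dμ dΩ`, `μ ∈ ℝ`. The squared norm of `exp (-cosh μ)` for it is `8π K₀(2)`. -/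
def coordMeasure : Measure Chart := (volume : Measure ℝ).prod sphereMeasure

/-- The Lorentz invariant measure `sinh² μ dμ dΩ`, `μ > 0`, of the hyperboloid. -/
def invMeasure : Measure Chart :=
  ((volume.restrict (Ioi 0)).withDensity fun m => ENNReal.ofReal (Real.sinh m ^ 2)).prod
    sphereMeasure

/-- The normalized spherically symmetric state `ψ₀ = N^(-1/2) exp (-cosh μ)`, where `N` is the
squared norm of `exp (-cosh μ)` in `V₃ = L²(ν)`. -/
def psi0 (ν : Measure Chart) (x : Chart) : ℂ :=
  ((1 / Real.sqrt (∫ y : Chart, Real.exp (-Real.cosh y.1) ^ 2 ∂ν)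
    * Real.exp (-Real.cosh x.1) : ℝ) : ℂ)

/-- Lebesgue measure on the half-line `ℝ₊ = [0, ∞)`, so that `h = L²(timeMeasure)`. -/
def timeMeasure : Measure ℝ := volume.restrict (Ici 0)

/-- Functions of `(s, x)`, `s` in the half-line and `x` in the hyperboloid: the vectors of
`H₃ = h ⊗ V₃ = L²(timeMeasure × ν)` are (classes of) such functions, see `InH`. -/
abbrev Vec : Type := ℝ → Chart → ℂ

/-- Operators acting on such functions; their product is the composition `∘`, and sums,
differences and scalar multiples are pointwise. -/
abbrev Op : Type := Vec → Vec

/-- `F` is square integrable, that is, `F` represents a vector of `H₃ = h ⊗ V₃`. -/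
def InH (ν : Measure Chart) (F : Vec) : Prop :=
  MemLp (fun p : ℝ × Chart => F p.1 p.2) 2 (timeMeasure.prod ν)

/-- `F` and `G` represent the same vector of `H₃`. -/
def SameVec (ν : Measure Chart) (F G : Vec) : Prop :=
  (fun p : ℝ × Chart => F p.1 p.2) =ᵐ[timeMeasure.prod ν] fun p => G p.1 p.2

/-- The scalar product of `H₃`. -/
def innerH (ν : Measure Chart) (F G : Vec) : ℂ :=
  ∫ p : ℝ × Chart, conj (F p.1 p.2) * G p.1 p.2 ∂(timeMeasure.prod ν)

/-- The vector `ψ(g) = g ⊗ ψ`. -/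
def tensor (g : ℝ → ℂ) (ψ : Chart → ℂ) : Vec := fun s x => g s * ψ x

/-- For an operator `B` on `V₃` and a function `f` on the half-line, `B(f)` is the operator
(multiplication by `f`) `⊗ B`, so that `B(f) ψ(g) = (B ψ)(f g)`. -/
def smear (B : (Chart → ℂ) → Chart → ℂ) (f : ℝ → ℂ) : Op :=
  fun F s x => f s * B (F s) x

/-- The process `B(t) = B(χ_[0,t])`. -/
def process (B : (Chart → ℂ) → Chart → ℂ) (t : ℝ) : Op :=
  smear B ((Icc 0 t).indicator 1)

/-- The stochastic differential `dB(t) = B(t + dt) - B(t)`. -/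
def differential (B : (Chart → ℂ) → Chart → ℂ) (t dt : ℝ) : Op :=
  process B (t + dt) - process B t

/-- `B(dt) = B(χ_dt)`, where `χ_dt` is the indicator function of the interval from `t` to
`t + dt`. -/
def onInterval (B : (Chart → ℂ) → Chart → ℂ) (t dt : ℝ) : Op :=
  smear B ((Ioc t (t + dt)).indicator 1)

/-- `X` and `Y` map every vector `ψ₀(g)`, `g ∈ h`, to one and the same vector of `H₃`. -/
def EqOnState (ν : Measure Chart) (X Y : Op) : Prop :=
  ∀ g : ℝ → ℂ, MemLp g 2 timeMeasure →
    InH ν (X (tensor g (psi0 ν))) ∧ InH ν (Y (tensor g (psi0 ν))) ∧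
      SameVec ν (X (tensor g (psi0 ν))) (Y (tensor g (psi0 ν)))

/-- `X` and `Y` have the same expectations in the state `ψ₀`: `X ψ₀(g)` and `Y ψ₀(g)` are vectors
of `H₃`, and `⟨ψ₀(f), X ψ₀(g)⟩ = ⟨ψ₀(f), Y ψ₀(g)⟩` for all `f, g ∈ h`. -/
def EqInExpectation (ν : Measure Chart) (X Y : Op) : Prop :=
  ∀ f g : ℝ → ℂ, MemLp f 2 timeMeasure → MemLp g 2 timeMeasure →
    InH ν (X (tensor g (psi0 ν))) ∧ InH ν (Y (tensor g (psi0 ν))) ∧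
      innerH ν (tensor f (psi0 ν)) (X (tensor g (psi0 ν)))
        = innerH ν (tensor f (psi0 ν)) (Y (tensor g (psi0 ν)))

end IsoThreeOne

end

namespace IsoThreeOne

/-! ### Radial measures -/

/-! Since the `μ`-derivative of `exp (-cosh μ)` is `-sinh μ · exp (-cosh μ)`, the boosts act on the
state as multiplications: `Qⁱψ₀ = -i ξᵢ ψ₀` (`opQ_psi0`). Hence `A₋ⁱψ₀ = 0` and `A₊ⁱψ₀ = -√2 i ξᵢ
ψ₀`.

A differential multiplies by the indicator of `(t, t + dt]` in the time variable, and this indicator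
is idempotent. Thus `differential_comp_tensor` reduces each rule to one about `A (B ψ₀)` in `V₃`.
The rule for `A₋ⁱA₊ʲ` comes from `Qⁱ(ξⱼψ₀) = i δᵢⱼ cosh μ ψ₀ - i ξᵢξⱼψ₀` (`opQ_opP_psi0`), which
expresses orthonormality of the spherical frame and holds off a null set. The rule for `A₋ⁱ𝔍` is a
direct computation.

The two rules with `𝔍` on the left fail as vector identities. Both sides have zero expectation,
because each component of the direction integrates to zero over the sphere (`integral_direction`).
Membership in `H₃` follows from the decay of `exp (-cosh μ)`, which absorbs any power of `cosh μ`.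
-/

lemma sq_div_four_le_cosh (m : ℝ) : m ^ 2 / 4 ≤ Real.cosh m := by
  have h := Real.quadratic_le_exp_of_nonneg (abs_nonneg m)
  rw [← Real.cosh_abs, Real.cosh_eq]
  have h1 := Real.exp_pos (-|m|)
  have h2 := abs_nonneg m
  have h3 := sq_abs m
  linarith

/-- One factor `exp (-cosh m)` absorbs the power through `cⁿ ≤ n! eᶜ`; the other lies below a
Gaussian. -/
lemma cosh_pow_mul_exp_le (n : ℕ) (m : ℝ) :
    Real.cosh m ^ n * Real.exp (-Real.cosh m) ^ 2 ≤ n.factorial * Real.exp (-(1 / 4) * m ^ 2) := by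
  have hc := (Real.cosh_pos m).le
  have h1 : Real.cosh m ^ n ≤ n.factorial * Real.exp (Real.cosh m) := by
    have := Real.pow_div_factorial_le_exp _ hc n
    rw [div_le_iff₀ (by positivity)] at this
    linarith
  have h2 : Real.exp (-Real.cosh m) ≤ Real.exp (-(1 / 4) * m ^ 2) :=
    Real.exp_le_exp.2 (by have := sq_div_four_le_cosh m; linarith)
  calc Real.cosh m ^ n * Real.exp (-Real.cosh m) ^ 2
      ≤ (n.factorial * Real.exp (Real.cosh m)) * Real.exp (-Real.cosh m) ^ 2 := by gcongr
    _ = n.factorial * Real.exp (-Real.cosh m) := by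
        have : Real.exp (Real.cosh m) * Real.exp (-Real.cosh m) = 1 := by
          rw [← Real.exp_add]; simp
        linear_combination (n.factorial * Real.exp (-Real.cosh m)) * this
    _ ≤ _ := by gcongr

lemma integrable_cosh_pow_mul_exp (n : ℕ) :
    Integrable (fun m : ℝ => Real.cosh m ^ n * Real.exp (-Real.cosh m) ^ 2) := by
  refine Integrable.mono' ((integrable_exp_neg_mul_sq (b := 1 / 4) (by norm_num)).const_mul
    (n.factorial : ℝ)) (by fun_prop) (Filter.Eventually.of_forall fun m => ?_)
  rw [Real.norm_of_nonneg (by have := Real.cosh_pos m; positivity)]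
  exact cosh_pow_mul_exp_le n m

/-- The radial part of a rotation invariant measure in the coordinates `(μ, θ₁, θ₂)` for which all
`cosh μ ^ n * exp (-2 cosh μ)` are integrable. -/
structure IsRadialPart (ρ : Measure ℝ) : Prop where
  sFinite : SFinite ρ
  ne_zero : ρ ≠ 0
  ae_ne_zero : ∀ᵐ m ∂ρ, m ≠ 0
  integrable : ∀ n : ℕ, Integrable (fun m : ℝ => Real.cosh m ^ n * Real.exp (-Real.cosh m) ^ 2) ρ

lemma isRadialPart_volume : IsRadialPart volume where
  sFinite := inferInstance
  ne_zero := NeZero.ne _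
  ae_ne_zero := Measure.ae_ne _ _
  integrable := integrable_cosh_pow_mul_exp

lemma isRadialPart_sinh_sq :
    IsRadialPart ((volume.restrict (Ioi 0)).withDensity fun m => ENNReal.ofReal (Real.sinh m ^ 2)) where
  sFinite := inferInstance
  ne_zero := by
    intro h
    have hac : volume.restrict (Ioi (0 : ℝ)) ≪
        (volume.restrict (Ioi 0)).withDensity fun m => ENNReal.ofReal (Real.sinh m ^ 2) := by
      -- The density is positive on `μ > 0`, so a zero weighted measure would force the half-line to
      -- be Lebesgue null.
      refine withDensity_absolutelyContinuous' (by fun_prop) ?_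
      filter_upwards [ae_restrict_mem measurableSet_Ioi] with m hm
      have := Real.sinh_pos_iff.2 hm
      simp only [ne_eq, ENNReal.ofReal_eq_zero, not_le]
      positivity
    rw [h] at hac
    have := Measure.absolutelyContinuous_zero_iff.1 hac
    rw [Measure.restrict_eq_zero] at this
    simp at this
  ae_ne_zero :=
    (withDensity_absolutelyContinuous _ _).ae_le (ae_restrict_of_ae (Measure.ae_ne _ _))
  integrable n := by
    rw [integrable_withDensity_iff (by fun_prop) (by simp)]
    -- The density is at most `cosh² m`, which raises the exponent by two.
    refine Integrable.mono' (integrable_cosh_pow_mul_exp (n + 2)).restrict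
      (by fun_prop) (Filter.Eventually.of_forall fun m => ?_)
    have hc := Real.cosh_pos m
    rw [ENNReal.toReal_ofReal (by positivity), Real.norm_of_nonneg (by positivity)]
    have : Real.sinh m ^ 2 ≤ Real.cosh m ^ 2 := by rw [Real.cosh_sq]; linarith
    calc _ ≤ Real.cosh m ^ n * Real.exp (-Real.cosh m) ^ 2 * Real.cosh m ^ 2 := by gcongr
      _ = _ := by ring

lemma exists_isRadialPart {ν : Measure Chart} (hν : ν = coordMeasure ∨ ν = invMeasure) :
    ∃ ρ : Measure ℝ, IsRadialPart ρ ∧ ν = ρ.prod sphereMeasure := by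
  rcases hν with rfl | rfl
  · exact ⟨_, isRadialPart_volume, rfl⟩
  · exact ⟨_, isRadialPart_sinh_sq, rfl⟩

/-! ### The measure on the sphere -/

lemma isFiniteMeasure_withDensity_sin :
    IsFiniteMeasure ((volume.restrict (Ioo 0 Real.pi)).withDensity
      fun a => ENNReal.ofReal (Real.sin a)) := by
  refine isFiniteMeasure_withDensity_ofReal (Integrable.hasFiniteIntegral ?_)
  exact (Real.continuous_sin.integrableOn_Icc (a := 0) (b := Real.pi)).mono_set Ioo_subset_Icc_self

instance : IsFiniteMeasure sphereMeasure := by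
  have := isFiniteMeasure_withDensity_sin
  unfold sphereMeasure
  infer_instance

lemma prod_ne_zero {α β : Type*} [MeasurableSpace α] [MeasurableSpace β] {μ : Measure α}
    {ν : Measure β} [SFinite ν] (hμ : μ ≠ 0) (hν : ν ≠ 0) : μ.prod ν ≠ 0 := by
  rw [← Measure.measure_univ_ne_zero, ← univ_prod_univ, Measure.prod_prod]
  exact mul_ne_zero (Measure.measure_univ_ne_zero.2 hμ) (Measure.measure_univ_ne_zero.2 hν)

lemma sphereMeasure_ne_zero : sphereMeasure ≠ 0 := by
  have := isFiniteMeasure_withDensity_sin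
  unfold sphereMeasure
  have hac : volume.restrict (Ioo 0 Real.pi) ≪
      (volume.restrict (Ioo 0 Real.pi)).withDensity fun a => ENNReal.ofReal (Real.sin a) := by
    refine withDensity_absolutelyContinuous' (by fun_prop) ?_
    filter_upwards [ae_restrict_mem measurableSet_Ioo] with a ha
    simpa using Real.sin_pos_of_mem_Ioo ha
  refine prod_ne_zero (fun h => ?_) fun h => ?_
  · rw [h, Measure.absolutelyContinuous_zero_iff, Measure.restrict_eq_zero] at hac
    simp [Real.pi_pos.not_ge] at hac
  · rw [Measure.restrict_eq_zero] at h
    simp [Real.pi_pos.not_ge] at h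

lemma ae_sin_ne_zero : ∀ᵐ y ∂sphereMeasure, Real.sin y.1 ≠ 0 := by
  have := isFiniteMeasure_withDensity_sin
  unfold sphereMeasure
  refine Measure.quasiMeasurePreserving_fst.ae (p := fun a : ℝ => Real.sin a ≠ 0) ?_
  refine (withDensity_absolutelyContinuous _ _).ae_le ?_
  filter_upwards [ae_restrict_mem measurableSet_Ioo] with a ha
  exact (Real.sin_pos_of_mem_Ioo ha).ne'

/-- The first two components vanish by integrating `cos θ₂` or `sin θ₂` over a full period, the
third by `∫ sin θ₁ cos θ₁ = 0` on `(0, π)`. -/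
lemma integral_direction (i : Fin 3) (m : ℝ) : ∫ y, direction i (m, y) ∂sphereMeasure = 0 := by
  have := isFiniteMeasure_withDensity_sin
  unfold sphereMeasure
  fin_cases i
  · simp only [direction]
    rw [integral_prod_mul Real.sin Real.cos, ← integral_Ioc_eq_integral_Ioo (x := 0),
      ← intervalIntegral.integral_of_le Real.two_pi_pos.le]
    simp
  · simp only [direction]
    rw [integral_prod_mul Real.sin Real.sin, ← integral_Ioc_eq_integral_Ioo (x := 0) (y := 2 * _),
      ← intervalIntegral.integral_of_le Real.two_pi_pos.le]
    simp
  · simp only [direction]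
    have h := integral_prod_mul (μ := (volume.restrict (Ioo 0 Real.pi)).withDensity
      fun a => ENNReal.ofReal (Real.sin a)) (ν := volume.restrict (Ioo 0 (2 * Real.pi)))
      Real.cos (fun _ => (1 : ℝ))
    simp only [mul_one] at h
    rw [h, integral_withDensity_eq_integral_toReal_smul (by fun_prop) (by simp)]
    have h2 : ∫ a in Ioo 0 Real.pi, (ENNReal.ofReal (Real.sin a)).toReal • Real.cos a = 0 := by
      rw [setIntegral_congr_fun (g := fun a => Real.sin a * Real.cos a) measurableSet_Ioo,
        ← integral_Ioc_eq_integral_Ioo, ← intervalIntegral.integral_of_le Real.pi_pos.le,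
        integral_sin_mul_cos₁]
      · simp
      · intro a ha
        simp [ENNReal.toReal_ofReal (Real.sin_pos_of_mem_Ioo ha).le]
    rw [h2, zero_mul]

/-! ### Vectors of `V₃` -/

lemma measurable_direction (i : Fin 3) : Measurable (direction i) := by
  fin_cases i <;> (unfold direction; dsimp only; fun_prop)

lemma abs_direction_le_one (i : Fin 3) (x : Chart) : |direction i x| ≤ 1 := by
  fin_cases i <;> simp only [direction]
  · rw [abs_mul]
    exact mul_le_one₀ (Real.abs_sin_le_one _) (abs_nonneg _) (Real.abs_cos_le_one _)
  · rw [abs_mul]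
    exact mul_le_one₀ (Real.abs_sin_le_one _) (abs_nonneg _) (Real.abs_sin_le_one _)
  · exact Real.abs_cos_le_one _

lemma measurable_psi0 (ν : Measure Chart) : Measurable (psi0 ν) := by
  unfold psi0; fun_prop

lemma norm_psi0 (ν : Measure Chart) (x : Chart) :
    ‖psi0 ν x‖ = 1 / Real.sqrt (∫ y : Chart, Real.exp (-Real.cosh y.1) ^ 2 ∂ν)
      * Real.exp (-Real.cosh x.1) := by
  unfold psi0
  rw [Complex.norm_real, Real.norm_of_nonneg (by positivity)]

section V3

variable {ρ : Measure ℝ}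

/-- This discards the points where `coth μ` or `1 / sin θ₁` takes the default value of division by
zero. -/
lemma ae_regular (hρ : IsRadialPart ρ) :
    ∀ᵐ x ∂(ρ.prod sphereMeasure), Real.sinh x.1 ≠ 0 ∧ Real.sin x.2.1 ≠ 0 := by
  have := hρ.sFinite
  filter_upwards [Measure.quasiMeasurePreserving_fst.ae hρ.ae_ne_zero,
    Measure.quasiMeasurePreserving_snd.ae ae_sin_ne_zero] with x h1 h2
  exact ⟨by simpa [Real.sinh_eq_zero] using h1, h2⟩

lemma integrable_exp_sq (hρ : IsRadialPart ρ) :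
    Integrable (fun x : Chart => Real.exp (-Real.cosh x.1) ^ 2) (ρ.prod sphereMeasure) := by
  have := hρ.sFinite
  simpa using (hρ.integrable 0).comp_fst sphereMeasure

/-- Multiples of `ψ₀` by functions that grow at most like `cosh² μ` are in `V₃`. -/
lemma memLp_mul_psi0 (hρ : IsRadialPart ρ) {u : Chart → ℂ} (hu : Measurable u) {C : ℝ}
    (hC : ∀ x, ‖u x‖ ≤ C * Real.cosh x.1 ^ 2) :
    MemLp (fun x => u x * psi0 (ρ.prod sphereMeasure) x) 2 (ρ.prod sphereMeasure) := by
  have := hρ.sFinite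
  set c := 1 / Real.sqrt (∫ y : Chart, Real.exp (-Real.cosh y.1) ^ 2 ∂(ρ.prod sphereMeasure))
    with hc
  have hc0 : 0 ≤ c := by positivity
  have hg : MemLp (fun x : Chart => C * c * (Real.cosh x.1 ^ 2 * Real.exp (-Real.cosh x.1))) 2
      (ρ.prod sphereMeasure) := by
    refine MemLp.const_mul ?_ _
    rw [memLp_two_iff_integrable_sq (by fun_prop)]
    -- Squaring a bound of order `cosh²` produces the fourth power.
    refine ((hρ.integrable 4).comp_fst sphereMeasure).congr (.of_forall fun x => ?_)
    ring
  refine hg.mono' (hu.mul (measurable_psi0 _)).aestronglyMeasurable (.of_forall fun x => ?_)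
  rw [norm_mul, norm_psi0, ← hc]
  calc _ ≤ C * Real.cosh x.1 ^ 2 * (c * Real.exp (-Real.cosh x.1)) := by
        gcongr; exact hC x
    _ = _ := by ring

lemma memLp_psi0 (hρ : IsRadialPart ρ) :
    MemLp (psi0 (ρ.prod sphereMeasure)) 2 (ρ.prod sphereMeasure) := by
  have h := memLp_mul_psi0 hρ (u := fun _ => 1) (C := 1) (by fun_prop) fun x => by
    have := Real.one_le_cosh x.1
    rw [norm_one, one_mul]
    exact one_le_pow₀ this
  simpa using h

lemma integral_norm_psi0_sq (hρ : IsRadialPart ρ) :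
    ∫ x, ‖psi0 (ρ.prod sphereMeasure) x‖ ^ 2 ∂(ρ.prod sphereMeasure) = 1 := by
  have := hρ.sFinite
  have hN : 0 < ∫ y : Chart, Real.exp (-Real.cosh y.1) ^ 2 ∂(ρ.prod sphereMeasure) := by
    rw [integral_pos_iff_support_of_nonneg (fun y => by positivity) (integrable_exp_sq hρ)]
    have hs : Function.support (fun y : Chart => Real.exp (-Real.cosh y.1) ^ 2) = univ :=
      Function.support_eq_univ fun y => (by positivity)
    rw [hs, pos_iff_ne_zero, Measure.measure_univ_ne_zero]
    exact prod_ne_zero hρ.ne_zero sphereMeasure_ne_zero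
  simp only [norm_psi0, mul_pow]
  rw [integral_const_mul, div_pow, Real.sq_sqrt hN.le, one_pow, one_div_mul_cancel hN.ne']

lemma memLp_opJ_psi0 (hρ : IsRadialPart ρ) :
    MemLp (opJ (psi0 (ρ.prod sphereMeasure))) 2 (ρ.prod sphereMeasure) := by
  refine memLp_mul_psi0 hρ (u := fun x => (Real.cosh x.1 : ℂ)) (C := 1) (by fun_prop) fun x => ?_
  have := Real.one_le_cosh x.1
  rw [Complex.norm_real, Real.norm_of_nonneg (by positivity)]
  nlinarith

lemma abs_sinh_le_cosh (m : ℝ) : |Real.sinh m| ≤ Real.cosh m :=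
  abs_le_of_sq_le_sq (by rw [Real.cosh_sq]; linarith) (Real.cosh_pos m).le

lemma memLp_opP_psi0 (hρ : IsRadialPart ρ) (i : Fin 3) :
    MemLp (opP i (psi0 (ρ.prod sphereMeasure))) 2 (ρ.prod sphereMeasure) := by
  have hd := measurable_direction i
  refine memLp_mul_psi0 hρ (u := fun x => ((Real.sinh x.1 * direction i x : ℝ) : ℂ)) (C := 1)
    (by fun_prop) fun x => ?_
  have := Real.one_le_cosh x.1
  have h1 := abs_sinh_le_cosh x.1
  have h2 := abs_direction_le_one i x
  rw [Complex.norm_real, Real.norm_eq_abs, abs_mul]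
  nlinarith [abs_nonneg (Real.sinh x.1), abs_nonneg (direction i x)]

lemma memLp_opJ_opP_psi0 (hρ : IsRadialPart ρ) (i : Fin 3) :
    MemLp (opJ (opP i (psi0 (ρ.prod sphereMeasure)))) 2 (ρ.prod sphereMeasure) := by
  have hd := measurable_direction i
  have h := memLp_mul_psi0 hρ
    (u := fun x => (Real.cosh x.1 : ℂ) * ((Real.sinh x.1 * direction i x : ℝ) : ℂ)) (C := 1)
    (by fun_prop) fun x => by
      have := Real.one_le_cosh x.1
      have h1 := abs_sinh_le_cosh x.1
      have h2 := abs_direction_le_one i x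
      rw [norm_mul, Complex.norm_real, Complex.norm_real, Real.norm_eq_abs, Real.norm_eq_abs,
        abs_mul, abs_of_pos (Real.cosh_pos _), one_mul, sq]
      gcongr
      nlinarith [abs_nonneg (Real.sinh x.1), abs_nonneg (direction i x)]
  refine h.ae_eq (.of_forall fun x => ?_)
  simp only [opJ, opP, mul_assoc]

/-- A radial function times a component of the direction is orthogonal to `ψ₀`. -/
lemma integral_conj_psi0_mul_direction (ρ : Measure ℝ) [SFinite ρ] (i : Fin 3) (r : ℝ → ℂ) :
    ∫ x, conj (psi0 (ρ.prod sphereMeasure) x) *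
      (r x.1 * (direction i x : ℂ) * psi0 (ρ.prod sphereMeasure) x) ∂(ρ.prod sphereMeasure) = 0 := by
  set ν := ρ.prod sphereMeasure
  have hd : ∀ x : Chart, direction i x = direction i (0, x.2) := fun x => by
    fin_cases i <;> rfl
  have hp : ∀ x : Chart, psi0 ν x = psi0 ν (x.1, 0) := fun x => rfl
  -- The product formula for the Bochner integral needs no integrability, so `r` may be arbitrary.
  have h := integral_prod_mul (μ := ρ) (ν := sphereMeasure)
    (fun m => conj (psi0 ν (m, 0)) * r m * psi0 ν (m, 0)) (fun y => (direction i (0, y) : ℂ))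
  rw [integral_complex_ofReal, integral_direction, Complex.ofReal_zero, mul_zero] at h
  rw [← h]
  refine integral_congr_ae (.of_forall fun x => ?_)
  simp only [hd x, hp x]
  ring

end V3

/-! ### The operators on multiples of `ψ₀` -/

/-- `B` commutes with multiplication by scalars. -/
def IsHomogeneous (B : (Chart → ℂ) → Chart → ℂ) : Prop :=
  ∀ (c : ℂ) (φ : Chart → ℂ), B (c • φ) = c • B φ

lemma isHomogeneous_opJ : IsHomogeneous opJ := fun c φ => by
  ext x; simp only [opJ, Pi.smul_apply, smul_eq_mul]; ring

lemma isHomogeneous_opP (i : Fin 3) : IsHomogeneous (opP i) := fun c φ => by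
  ext x; simp only [opP, Pi.smul_apply, smul_eq_mul]; ring

/-- Constants pass through `deriv` even where `φ` is not differentiable. Homogeneity suffices on
simple tensors, since each time slice of `g ⊗ φ` is the multiple `g s • φ`. -/
lemma isHomogeneous_opQ (i : Fin 3) : IsHomogeneous (opQ i) := fun c φ => by
  have h1 : partialMu (c • φ) = c • partialMu φ := by
    ext x; simp [partialMu, deriv_const_mul_field]
  have h2 : partialTheta1 (c • φ) = c • partialTheta1 φ := by
    ext x; simp [partialTheta1, deriv_const_mul_field]
  have h3 : partialTheta2 (c • φ) = c • partialTheta2 φ := by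
    ext x; simp [partialTheta2, deriv_const_mul_field]
  ext x
  fin_cases i <;> simp only [Fin.zero_eta, Fin.mk_one, Fin.reduceFinMk, opQ, h1, h2, h3,
    Pi.smul_apply, smul_eq_mul] <;> ring

lemma isHomogeneous_opAminus (i : Fin 3) : IsHomogeneous (opAminus i) := fun c φ => by
  ext x
  simp only [opAminus, isHomogeneous_opQ i c φ, isHomogeneous_opP i c φ, Pi.smul_apply,
    smul_eq_mul]
  ring

lemma isHomogeneous_opAplus (i : Fin 3) : IsHomogeneous (opAplus i) := fun c φ => by
  ext x
  simp only [opAplus, isHomogeneous_opQ i c φ, isHomogeneous_opP i c φ, Pi.smul_apply,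
    smul_eq_mul]
  ring

lemma opQ_radial (i : Fin 3) (F : ℝ → ℂ) (x : Chart) :
    opQ i (fun y => F y.1) x = Complex.I * (direction i x * deriv F x.1) := by
  fin_cases i <;> simp [opQ, direction, partialMu, partialTheta1, partialTheta2]

lemma hasDerivAt_psi0 (ν : Measure Chart) (m : ℝ) (y : ℝ × ℝ) :
    HasDerivAt (fun m => psi0 ν (m, y)) (-(Real.sinh m : ℂ) * psi0 ν (m, y)) m := by
  have h := (((Real.hasDerivAt_cosh m).fun_neg.exp).const_mul
    (1 / Real.sqrt (∫ y : Chart, Real.exp (-Real.cosh y.1) ^ 2 ∂ν))).ofReal_comp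
  refine h.congr_deriv ?_
  simp only [psi0]
  push_cast
  ring

lemma opQ_psi0 (ν : Measure Chart) (i : Fin 3) :
    opQ i (psi0 ν) = (-Complex.I) • opP i (psi0 ν) := by
  ext x
  have h := opQ_radial i (fun m => psi0 ν (m, x.2)) x
  rw [(hasDerivAt_psi0 ν x.1 x.2).deriv] at h
  simp only [opP, Pi.smul_apply, smul_eq_mul]
  refine h.trans ?_
  push_cast
  ring

/-- The `1` comes from differentiating `cosh μ`, the `-cosh μ` from differentiating the state. -/
lemma opQ_opJ_psi0 (ν : Measure Chart) (i : Fin 3) (x : Chart) :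
    opQ i (opJ (psi0 ν)) x
      = Complex.I * (1 - (Real.cosh x.1 : ℂ)) * opP i (psi0 ν) x := by
  have h := opQ_radial i (fun m => (Real.cosh m : ℂ) * psi0 ν (m, x.2)) x
  rw [((Real.hasDerivAt_cosh x.1).ofReal_comp.fun_mul (hasDerivAt_psi0 ν x.1 x.2)).deriv] at h
  refine h.trans ?_
  simp only [opP]
  push_cast
  ring

lemma opAminus_psi0 (ν : Measure Chart) (i : Fin 3) : opAminus i (psi0 ν) = 0 := by
  ext x
  simp [opAminus, opQ_psi0]

lemma sqrt_two_mul_self : (Real.sqrt 2 : ℂ) * (Real.sqrt 2 : ℂ) = 2 := by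
  rw [← Complex.ofReal_mul, Real.mul_self_sqrt (by norm_num)]; norm_num

lemma sqrt_two_ne_zero : (Real.sqrt 2 : ℂ) ≠ 0 := by
  rw [Complex.ofReal_ne_zero]; positivity

lemma opAplus_psi0 (ν : Measure Chart) (i : Fin 3) :
    opAplus i (psi0 ν) = (-(Real.sqrt 2 : ℂ) * Complex.I) • opP i (psi0 ν) := by
  ext x
  have h := sqrt_two_ne_zero
  simp only [opAplus, opQ_psi0, Pi.smul_apply, smul_eq_mul]
  field_simp
  linear_combination opP i (psi0 ν) x * sqrt_two_mul_self

lemma opAminus_opJ_psi0 (ν : Measure Chart) (i : Fin 3) :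
    opAminus i (opJ (psi0 ν)) = (Complex.I / (Real.sqrt 2 : ℂ)) • opP i (psi0 ν) := by
  ext x
  have h := sqrt_two_ne_zero
  simp only [opAminus, opQ_opJ_psi0, Pi.smul_apply, smul_eq_mul]
  simp only [opP, opJ]
  ring

/-- `∂gᵢ/∂θ₁`. -/
noncomputable def directionTheta1 (i : Fin 3) (x : Chart) : ℝ :=
  ![Real.cos x.2.1 * Real.cos x.2.2, Real.cos x.2.1 * Real.sin x.2.2, -Real.sin x.2.1] i

/-- `(sin θ₁)⁻¹ ∂gᵢ/∂θ₂`. -/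
noncomputable def directionTheta2 (i : Fin 3) (x : Chart) : ℝ :=
  ![-Real.sin x.2.2, Real.cos x.2.2, 0] i

lemma hasDerivAt_direction_theta1 (i : Fin 3) (m a b : ℝ) :
    HasDerivAt (fun a => direction i (m, a, b)) (directionTheta1 i (m, a, b)) a := by
  fin_cases i
  · exact (Real.hasDerivAt_sin a).mul_const (Real.cos b)
  · exact (Real.hasDerivAt_sin a).mul_const (Real.sin b)
  · exact Real.hasDerivAt_cos a

lemma hasDerivAt_direction_theta2 (i : Fin 3) (m a b : ℝ) :
    HasDerivAt (fun b => direction i (m, a, b)) (Real.sin a * directionTheta2 i (m, a, b)) b := by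
  fin_cases i
  · exact (Real.hasDerivAt_cos b).const_mul (Real.sin a)
  · exact (Real.hasDerivAt_sin b).const_mul (Real.sin a)
  · exact (hasDerivAt_const b (Real.cos a)).congr_deriv (by simp [directionTheta2])

/-- The frame `(g, ∂g/∂θ₁, (sin θ₁)⁻¹ ∂g/∂θ₂)` is orthonormal. -/
lemma direction_orthonormal (i j : Fin 3) (x : Chart) :
    direction i x * direction j x + directionTheta1 i x * directionTheta1 j x
      + directionTheta2 i x * directionTheta2 j x = if i = j then 1 else 0 := by
  have ha := Real.sin_sq_add_cos_sq x.2.1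
  have hb := Real.sin_sq_add_cos_sq x.2.2
  fin_cases i <;> fin_cases j <;> simp [direction, directionTheta1, directionTheta2] <;> grind

/-- One formula for all three boosts: the radial derivative along `g` plus `coth μ` times the
spherical gradient in the orthonormal frame. -/
lemma opQ_eq (i : Fin 3) (φ : Chart → ℂ) (x : Chart) :
    opQ i φ x = Complex.I * (direction i x * partialMu φ x + (coth x.1 : ℂ) *
      (directionTheta1 i x * partialTheta1 φ x
        + directionTheta2 i x / Real.sin x.2.1 * partialTheta2 φ x)) := by
  fin_cases i <;> simp [opQ, direction, directionTheta1, directionTheta2] <;> ring_nf <;> simp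

/-- The boosts act on `ξⱼ ψ₀` away from the singularities of the coordinates. -/
lemma opQ_opP_psi0 (ν : Measure Chart) (i j : Fin 3) (x : Chart) (h1 : Real.sinh x.1 ≠ 0)
    (h2 : Real.sin x.2.1 ≠ 0) :
    opQ i (opP j (psi0 ν)) x = Complex.I * (if i = j then 1 else 0) * opJ (psi0 ν) x
      - Complex.I * opP i (opP j (psi0 ν)) x := by
  obtain ⟨m, a, b⟩ := x
  simp only at h1 h2
  have hμ : partialMu (opP j (psi0 ν)) (m, a, b)
      = ((Real.cosh m : ℂ) - Real.sinh m ^ 2) * direction j (m, a, b) * psi0 ν (m, a, b) := by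
    have hd : ∀ m', direction j (m', a, b) = direction j (m, a, b) := fun m' => by
      fin_cases j <;> rfl
    have h := (((Real.hasDerivAt_sinh m).mul_const (direction j (m, a, b))).ofReal_comp.fun_mul
      (hasDerivAt_psi0 ν m (a, b))).deriv
    simp only [partialMu, opP, hd]
    refine h.trans ?_
    push_cast
    ring
  have hθ₁ : partialTheta1 (opP j (psi0 ν)) (m, a, b)
      = Real.sinh m * directionTheta1 j (m, a, b) * psi0 ν (m, a, b) := by
    have h := (((hasDerivAt_direction_theta1 j m a b).const_mul
      (Real.sinh m)).ofReal_comp.mul_const (psi0 ν (m, a, b))).deriv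
    refine Eq.trans h ?_
    push_cast
    ring
  have hθ₂ : partialTheta2 (opP j (psi0 ν)) (m, a, b)
      = Real.sinh m * (Real.sin a * directionTheta2 j (m, a, b)) * psi0 ν (m, a, b) := by
    have h := (((hasDerivAt_direction_theta2 j m a b).const_mul
      (Real.sinh m)).ofReal_comp.mul_const (psi0 ν (m, a, b))).deriv
    refine Eq.trans h ?_
    push_cast
    ring
  have hcoth : (coth m : ℂ) * Real.sinh m = Real.cosh m := by
    rw [← Complex.ofReal_mul, coth, div_mul_cancel₀ _ h1]
  have hsin : (Real.sin a : ℂ)⁻¹ * Real.sin a = 1 :=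
    inv_mul_cancel₀ (Complex.ofReal_ne_zero.2 h2)
  have ho : ((direction i (m, a, b) * direction j (m, a, b)
      + directionTheta1 i (m, a, b) * directionTheta1 j (m, a, b)
      + directionTheta2 i (m, a, b) * directionTheta2 j (m, a, b) : ℝ) : ℂ)
      = if i = j then 1 else 0 := by
    rw [direction_orthonormal]; split_ifs <;> simp
  rw [opQ_eq, hμ, hθ₁, hθ₂, ← ho]
  simp only [opP, opJ, Complex.ofReal_mul, Complex.ofReal_add, div_eq_mul_inv]
  generalize (direction i (m, a, b) : ℂ) = di
  generalize (direction j (m, a, b) : ℂ) = dj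
  generalize (directionTheta1 i (m, a, b) : ℂ) = ei
  generalize (directionTheta1 j (m, a, b) : ℂ) = ej
  generalize (directionTheta2 i (m, a, b) : ℂ) = fi
  generalize (directionTheta2 j (m, a, b) : ℂ) = fj
  generalize psi0 ν (m, a, b) = p
  -- The tangential terms carry `coth μ · sinh μ = cosh μ`, matching the `cosh μ` of the radial
  -- term, so the frame completes to `δᵢⱼ cosh μ`; the radial `-sinh² μ` gives `-ξᵢξⱼ`.
  linear_combination Complex.I * p * (ei * ej + fi * fj) * hcoth
    + Complex.I * p * fi * fj * coth m * Real.sinh m * hsin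

/-- The term `i Pⁱ` in `A₋ⁱ` cancels the `-i ξᵢξⱼ` produced by the boost, leaving only the `δᵢⱼ`
term. -/
lemma opAminus_opAplus_psi0 (ν : Measure Chart) (i j : Fin 3) (x : Chart)
    (h1 : Real.sinh x.1 ≠ 0) (h2 : Real.sin x.2.1 ≠ 0) :
    opAminus i (opAplus j (psi0 ν)) x = (if i = j then (1 : ℂ) else 0) * opJ (psi0 ν) x := by
  have h := sqrt_two_ne_zero
  rw [opAplus_psi0, isHomogeneous_opAminus]
  simp only [opAminus, opQ_opP_psi0 ν i j x h1 h2, Pi.smul_apply, smul_eq_mul]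
  field_simp
  linear_combination -((if i = j then (1 : ℂ) else 0) * opJ (psi0 ν) x) * Complex.I_sq

/-! ### Differentials on the vectors `ψ(g)` -/

/-- For `t, dt ≥ 0` the set `[0, t + dt] \ [0, t]` is exactly `(t, t + dt]`, so the equality is
pointwise, endpoints included. -/
lemma differential_eq_onInterval (B : (Chart → ℂ) → Chart → ℂ) {t dt : ℝ} (ht : 0 ≤ t)
    (hdt : 0 ≤ dt) : differential B t dt = onInterval B t dt := by
  ext F s x
  simp only [differential, process, onInterval, smear, Pi.sub_apply, ← sub_mul]
  congr 1
  simp only [indicator_apply, mem_Icc, mem_Ioc, Pi.one_apply]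
  grind

lemma onInterval_tensor {B : (Chart → ℂ) → Chart → ℂ} (hB : IsHomogeneous B) (t dt : ℝ)
    (g : ℝ → ℂ) (φ : Chart → ℂ) :
    onInterval B t dt (tensor g φ) = tensor ((Ioc t (t + dt)).indicator g) (B φ) := by
  ext s x
  have h : B (tensor g φ s) x = g s * B φ x := congrFun (hB (g s) φ) x
  simp only [onInterval, smear, h, tensor]
  by_cases hs : s ∈ Ioc t (t + dt) <;> simp [hs]

lemma differential_tensor {B : (Chart → ℂ) → Chart → ℂ} (hB : IsHomogeneous B) {t dt : ℝ}
    (ht : 0 ≤ t) (hdt : 0 ≤ dt) (g : ℝ → ℂ) (φ : Chart → ℂ) :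
    differential B t dt (tensor g φ) = tensor ((Ioc t (t + dt)).indicator g) (B φ) := by
  rw [differential_eq_onInterval B ht hdt, onInterval_tensor hB]

lemma differential_comp_tensor {A B : (Chart → ℂ) → Chart → ℂ} (hA : IsHomogeneous A)
    (hB : IsHomogeneous B) {t dt : ℝ} (ht : 0 ≤ t) (hdt : 0 ≤ dt) (g : ℝ → ℂ) (φ : Chart → ℂ) :
    (differential A t dt ∘ differential B t dt) (tensor g φ)
      = tensor ((Ioc t (t + dt)).indicator g) (A (B φ)) := by
  rw [Function.comp_apply, differential_tensor hB ht hdt, differential_tensor hA ht hdt,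
    indicator_indicator, inter_self]

lemma smul_tensor (c : ℂ) (g : ℝ → ℂ) (φ : Chart → ℂ) : c • tensor g φ = tensor g (c • φ) := by
  ext s x; simp only [tensor, Pi.smul_apply, smul_eq_mul]; ring

lemma sub_tensor (g : ℝ → ℂ) (φ φ' : Chart → ℂ) :
    tensor g φ - tensor g φ' = tensor g (φ - φ') := by
  ext s x; simp only [tensor, Pi.sub_apply]; ring

lemma neg_tensor (g : ℝ → ℂ) (φ : Chart → ℂ) : -tensor g φ = tensor g (-φ) := by
  ext s x; simp only [tensor, Pi.neg_apply]; ring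

lemma tensor_zero (g : ℝ → ℂ) : tensor g 0 = 0 := by
  ext s x; simp [tensor]

instance : SFinite timeMeasure := by unfold timeMeasure; infer_instance

lemma inH_tensor {ν : Measure Chart} [SFinite ν] {g : ℝ → ℂ} {φ : Chart → ℂ}
    (hg : MemLp g 2 timeMeasure) (hφ : MemLp φ 2 ν) : InH ν (tensor g φ) := by
  have hm : AEStronglyMeasurable (fun p : ℝ × Chart => tensor g φ p.1 p.2) (timeMeasure.prod ν) :=
    hg.1.comp_fst.mul hφ.1.comp_snd
  refine (memLp_two_iff_integrable_sq_norm hm).2 ?_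
  refine (((memLp_two_iff_integrable_sq_norm hg.1).1 hg).mul_prod
    ((memLp_two_iff_integrable_sq_norm hφ.1).1 hφ)).congr (.of_forall fun p => ?_)
  simp only [tensor, norm_mul, mul_pow]

lemma sameVec_tensor {ν : Measure Chart} [SFinite ν] (g : ℝ → ℂ) {φ φ' : Chart → ℂ}
    (h : φ =ᵐ[ν] φ') : SameVec ν (tensor g φ) (tensor g φ') := by
  filter_upwards [Measure.quasiMeasurePreserving_snd.ae h] with p hp
  simp only [tensor, hp]

lemma innerH_tensor (ν : Measure Chart) [SFinite ν] (f g : ℝ → ℂ) (ψ φ : Chart → ℂ) :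
    innerH ν (tensor f ψ) (tensor g φ)
      = (∫ s, conj (f s) * g s ∂timeMeasure) * ∫ x, conj (ψ x) * φ x ∂ν := by
  rw [← integral_prod_mul]
  refine integral_congr_ae (.of_forall fun p => ?_)
  simp only [tensor, map_mul]
  ring

lemma EqOnState.eqInExpectation {ν : Measure Chart} {X Y : Op} (h : EqOnState ν X Y) :
    EqInExpectation ν X Y := fun f g _ hg => by
  obtain ⟨hX, hY, hXY⟩ := h g hg
  refine ⟨hX, hY, integral_congr_ae ?_⟩
  filter_upwards [hXY] with p hp
  rw [hp]

/-! ### The multiplication rules -/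

section Rules

variable {ρ : Measure ℝ} {t dt : ℝ}

lemma half_opAminus_sub_opAplus_psi0 (ν : Measure Chart) (i : Fin 3) :
    (1 / 2 : ℂ) • (opAminus i (psi0 ν) - opAplus i (psi0 ν))
      = (Complex.I / (Real.sqrt 2 : ℂ)) • opP i (psi0 ν) := by
  have h := sqrt_two_ne_zero
  rw [opAminus_psi0, opAplus_psi0, zero_sub, ← neg_smul, smul_smul]
  congr 1
  field_simp
  linear_combination sqrt_two_mul_self

lemma half_onInterval_sub_tensor (ν : Measure Chart) (t dt : ℝ) (i : Fin 3) (g : ℝ → ℂ) :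
    ((1 / 2 : ℂ) • (onInterval (opAminus i) t dt - onInterval (opAplus i) t dt))
        (tensor g (psi0 ν))
      = tensor ((Ioc t (t + dt)).indicator g)
        ((Complex.I / (Real.sqrt 2 : ℂ)) • opP i (psi0 ν)) := by
  rw [Pi.smul_apply, Pi.sub_apply, onInterval_tensor (isHomogeneous_opAminus i),
    onInterval_tensor (isHomogeneous_opAplus i), sub_tensor, smul_tensor,
    half_opAminus_sub_opAplus_psi0]

lemma integral_conj_psi0_mul_smul_opP (ρ : Measure ℝ) [SFinite ρ] (c : ℂ) (i : Fin 3) :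
    ∫ x, conj (psi0 (ρ.prod sphereMeasure) x) *
      (c • opP i (psi0 (ρ.prod sphereMeasure))) x ∂(ρ.prod sphereMeasure) = 0 := by
  rw [← integral_conj_psi0_mul_direction ρ i fun m => c * Real.sinh m]
  refine integral_congr_ae (.of_forall fun x => ?_)
  simp only [opP, Pi.smul_apply, smul_eq_mul, Complex.ofReal_mul]
  ring

lemma eqOnState_opAminus_opAplus (hρ : IsRadialPart ρ) (ht : 0 ≤ t) (hdt : 0 ≤ dt)
    (i j : Fin 3) :
    EqOnState (ρ.prod sphereMeasure)
      (differential (opAminus i) t dt ∘ differential (opAplus j) t dt)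
      ((if i = j then (1 : ℂ) else 0) • onInterval opJ t dt) := fun g hg => by
  have := hρ.sFinite
  rw [differential_comp_tensor (isHomogeneous_opAminus i) (isHomogeneous_opAplus j) ht hdt,
    Pi.smul_apply, onInterval_tensor isHomogeneous_opJ, smul_tensor]
  have hg' := hg.indicator (measurableSet_Ioc (a := t) (b := t + dt))
  have hJ := (memLp_opJ_psi0 hρ).const_smul (if i = j then (1 : ℂ) else 0)
  have hae : opAminus i (opAplus j (psi0 (ρ.prod sphereMeasure))) =ᵐ[ρ.prod sphereMeasure]
      (if i = j then (1 : ℂ) else 0) • opJ (psi0 (ρ.prod sphereMeasure)) := by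
    filter_upwards [ae_regular hρ] with x hx
    exact opAminus_opAplus_psi0 _ i j x hx.1 hx.2
  exact ⟨inH_tensor hg' (hJ.ae_eq hae.symm), inH_tensor hg' hJ, sameVec_tensor _ hae⟩

lemma IsHomogeneous.map_zero {B : (Chart → ℂ) → Chart → ℂ} (hB : IsHomogeneous B) : B 0 = 0 := by
  simpa using hB 0 0

lemma inH_zero (ν : Measure Chart) : InH ν 0 := MemLp.zero

lemma eqOnState_opAplus_opAminus (ν : Measure Chart) (ht : 0 ≤ t) (hdt : 0 ≤ dt) (i j : Fin 3) :
    EqOnState ν (differential (opAplus i) t dt ∘ differential (opAminus j) t dt) 0 :=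
  fun g _ => by
  rw [differential_comp_tensor (isHomogeneous_opAplus i) (isHomogeneous_opAminus j) ht hdt,
    opAminus_psi0, (isHomogeneous_opAplus i).map_zero, tensor_zero, Pi.zero_apply]
  exact ⟨inH_zero ν, inH_zero ν, ae_eq_rfl⟩

lemma eqOnState_opAminus_opJ (hρ : IsRadialPart ρ) (ht : 0 ≤ t) (hdt : 0 ≤ dt) (i : Fin 3) :
    EqOnState (ρ.prod sphereMeasure)
      (differential (opAminus i) t dt ∘ differential opJ t dt)
      ((1 / 2 : ℂ) • (onInterval (opAminus i) t dt - onInterval (opAplus i) t dt)) :=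
  fun g hg => by
  have := hρ.sFinite
  rw [differential_comp_tensor (isHomogeneous_opAminus i) isHomogeneous_opJ ht hdt,
    opAminus_opJ_psi0, half_onInterval_sub_tensor]
  have h := inH_tensor (hg.indicator (measurableSet_Ioc (a := t) (b := t + dt)))
    ((memLp_opP_psi0 hρ i).const_smul (Complex.I / (Real.sqrt 2 : ℂ)))
  exact ⟨h, h, ae_eq_rfl⟩

/-- The left side annihilates `ψ₀(g)`, while the right side gives a multiple of `ξᵢ ψ₀`, which is
orthogonal to `ψ₀`. -/
lemma eqInExpectation_opJ_opAminus (hρ : IsRadialPart ρ) (ht : 0 ≤ t) (hdt : 0 ≤ dt)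
    (i : Fin 3) :
    EqInExpectation (ρ.prod sphereMeasure)
      (-(differential opJ t dt ∘ differential (opAminus i) t dt))
      ((1 / 2 : ℂ) • (onInterval (opAminus i) t dt - onInterval (opAplus i) t dt)) :=
  fun f g _ hg => by
  have := hρ.sFinite
  rw [Pi.neg_apply, differential_comp_tensor isHomogeneous_opJ (isHomogeneous_opAminus i) ht hdt,
    opAminus_psi0, isHomogeneous_opJ.map_zero, tensor_zero, neg_zero, half_onInterval_sub_tensor,
    innerH_tensor, integral_conj_psi0_mul_smul_opP, mul_zero]
  refine ⟨inH_zero _, inH_tensor (hg.indicator measurableSet_Ioc)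
    ((memLp_opP_psi0 hρ i).const_smul _), ?_⟩
  simp [innerH]

/-- The sides give `√2 i cosh μ ξᵢ ψ₀` and `(i/√2) ξᵢ ψ₀`: different vectors, both orthogonal to
`ψ₀`. -/
lemma eqInExpectation_opJ_opAplus (hρ : IsRadialPart ρ) (ht : 0 ≤ t) (hdt : 0 ≤ dt)
    (i : Fin 3) :
    EqInExpectation (ρ.prod sphereMeasure)
      (-(differential opJ t dt ∘ differential (opAplus i) t dt))
      ((1 / 2 : ℂ) • (onInterval (opAminus i) t dt - onInterval (opAplus i) t dt)) :=
  fun f g _ hg => by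
  have := hρ.sFinite
  have hg' := hg.indicator (measurableSet_Ioc (a := t) (b := t + dt))
  rw [Pi.neg_apply, differential_comp_tensor isHomogeneous_opJ (isHomogeneous_opAplus i) ht hdt,
    opAplus_psi0, isHomogeneous_opJ, neg_tensor, ← neg_smul, half_onInterval_sub_tensor,
    innerH_tensor, innerH_tensor, integral_conj_psi0_mul_smul_opP]
  refine ⟨inH_tensor hg' ((memLp_opJ_opP_psi0 hρ i).const_smul _),
    inH_tensor hg' ((memLp_opP_psi0 hρ i).const_smul _), ?_⟩
  congr 1
  rw [← integral_conj_psi0_mul_direction ρ i fun m =>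
    -(-(Real.sqrt 2 : ℂ) * Complex.I) * Real.cosh m * Real.sinh m]
  refine integral_congr_ae (.of_forall fun x => ?_)
  simp only [opP, opJ, Pi.smul_apply, smul_eq_mul, Complex.ofReal_mul]
  ring

lemma inH_differential (hρ : IsRadialPart ρ) (ht : 0 ≤ t) (hdt : 0 ≤ dt) (i : Fin 3)
    {g : ℝ → ℂ} (hg : MemLp g 2 timeMeasure) :
    InH (ρ.prod sphereMeasure)
      (differential (opAminus i) t dt (tensor g (psi0 (ρ.prod sphereMeasure)))) ∧
    InH (ρ.prod sphereMeasure)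
      (differential (opAplus i) t dt (tensor g (psi0 (ρ.prod sphereMeasure)))) ∧
    InH (ρ.prod sphereMeasure)
      (differential opJ t dt (tensor g (psi0 (ρ.prod sphereMeasure)))) := by
  have := hρ.sFinite
  have hg' := hg.indicator (measurableSet_Ioc (a := t) (b := t + dt))
  rw [differential_tensor (isHomogeneous_opAminus i) ht hdt,
    differential_tensor (isHomogeneous_opAplus i) ht hdt,
    differential_tensor isHomogeneous_opJ ht hdt, opAminus_psi0, opAplus_psi0, tensor_zero]
  exact ⟨inH_zero _, inH_tensor hg' ((memLp_opP_psi0 hρ i).const_smul _),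
    inH_tensor hg' (memLp_opJ_psi0 hρ)⟩

end Rules

end IsoThreeOne

open IsoThreeOne in
theorem mainTheorem3 (ν : Measure Chart) (hν : ν = coordMeasure ∨ ν = invMeasure)
    (t dt : ℝ) (ht : 0 ≤ t) (hdt : 0 ≤ dt) (i j : Fin 3) :
    -- the state is normalized, and the differentials map `ψ₀(g)` into `H₃`
    (MemLp (psi0 ν) 2 ν ∧ ∫ x, ‖psi0 ν x‖ ^ 2 ∂ν = 1) ∧
    (∀ g : ℝ → ℂ, MemLp g 2 timeMeasure →
      InH ν (differential (opAminus i) t dt (tensor g (psi0 ν))) ∧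
      InH ν (differential (opAplus i) t dt (tensor g (psi0 ν))) ∧
      InH ν (differential opJ t dt (tensor g (psi0 ν)))) ∧
    -- the multiplication rules for expectations in the state `ψ₀`
    EqInExpectation ν
      (differential (opAminus i) t dt ∘ differential (opAplus j) t dt)
      ((if i = j then (1 : ℂ) else 0) • onInterval opJ t dt) ∧
    EqInExpectation ν
      (differential (opAplus i) t dt ∘ differential (opAminus j) t dt) 0 ∧
    EqInExpectation ν
      (differential (opAminus i) t dt ∘ differential opJ t dt)
      ((1 / 2 : ℂ) • (onInterval (opAminus i) t dt - onInterval (opAplus i) t dt)) ∧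
    EqInExpectation ν
      (-(differential opJ t dt ∘ differential (opAminus i) t dt))
      ((1 / 2 : ℂ) • (onInterval (opAminus i) t dt - onInterval (opAplus i) t dt)) ∧
    EqInExpectation ν
      (-(differential opJ t dt ∘ differential (opAplus i) t dt))
      ((1 / 2 : ℂ) • (onInterval (opAminus i) t dt - onInterval (opAplus i) t dt)) ∧
    -- the rules that hold as identities between vectors, applied to `ψ₀(g)`
    EqOnState ν
      (differential (opAminus i) t dt ∘ differential (opAplus j) t dt)
      ((if i = j then (1 : ℂ) else 0) • onInterval opJ t dt) ∧
    EqOnState ν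
      (differential (opAplus i) t dt ∘ differential (opAminus j) t dt) 0 ∧
    EqOnState ν
      (differential (opAminus i) t dt ∘ differential opJ t dt)
      ((1 / 2 : ℂ) • (onInterval (opAminus i) t dt - onInterval (opAplus i) t dt)) := by
  obtain ⟨ρ, hρ, rfl⟩ := exists_isRadialPart hν
  have h1 := eqOnState_opAminus_opAplus hρ ht hdt i j
  have h2 := eqOnState_opAplus_opAminus (ρ.prod sphereMeasure) ht hdt i j
  have h3 := eqOnState_opAminus_opJ hρ ht hdt i
  exact ⟨⟨memLp_psi0 hρ, integral_norm_psi0_sq hρ⟩, fun g hg => inH_differential hρ ht hdt i hg,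
    h1.eqInExpectation, h2.eqInExpectation, h3.eqInExpectation,
    eqInExpectation_opJ_opAminus hρ ht hdt i, eqInExpectation_opJ_opAplus hρ ht hdt i, h1, h2, h3⟩
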